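/- Let $d\ge 2$, let $p_k=(p_{1,k},\dots,p_{n_k,k})\in\mathbb R_+^{n_k}$ $(k=1,\dots,d)$ be probability vectors and let $C\in\mathbb R^{n_1\times\cdots\times n_d}$ be a cost tensor. Let $U(P)$ be the set of nonnegative tensors $U\in\mathbb R^{n_1\times\cdots\times n_d}$ whose $k$-th marginal (sum over all indices but the $k$-th) is $p_k$ for every $k$, and put $$\tau=\tau(C,P)=\min_{U\in U(P)}\langle C,U\rangle,\qquad T=\max_{U\in U(P)}\langle C,U\rangle .$$ Assume that there are real numbers $K>0$, $\ell\ge 1$ such that each $p_k$ is a weak $K$-$\ell$ uniform distribution: $p_{j,k}\ge K/n_k^{\ell}$ for all $j$, and $K\le n_k^{\ell-1}$. Let $E$ be the space of tensors with all marginals zero and let $\tilde\sigma(u)=-\sum_{i_1,\dots,i_d}\log x_{i_1,\dots,i_d}$, $X=p_1\otimes\cdots\otimes p_d+u$, be the logarithmic barrier restricted to the $u\in E$ for which $X$ is entrywise positive. Write $g=D\tilde\sigma$, $H=D^2\tilde\sigma$ and $\|v\|_u=\sqrt{H(u)[v,v]}$. Let $\theta(\tilde\sigma)$ be the complexity value of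 $\tilde\sigma$: the supremum over $u$ in this domain of the least $\lambda^2\in[0,\infty]$ with $|g(u)[v]|^2\le\lambda^2H(u)[v,v]$ for all $v\in E$. Then $\theta(\tilde\sigma)\le\prod_{k}n_k$. Let $\vartheta$ be any real number with $\theta(\tilde\sigma)\le\vartheta\le\prod_k n_k$. The short-step interior point method with barrier $\tilde\sigma$ and parameter $\vartheta$, started at $p_1\otimes\cdots\otimes p_d$ (that is, at $u=0$), makes one Newton step per iteration, as follows. * Stage 1, starting with $\nu=1$. At the current $u$, if $\|H(u)^{-1}g(u)\|_u>1/7$, replace $\nu$ by $\bigl(1-\tfrac1{8\sqrt\vartheta}\bigr)\nu$ and make a Newton step for $\tilde\sigma-\nu\,g(0)$. Otherwise make a Newton step for $\tilde\sigma$, put $\eta=1/(12\|H(u)^{-1}C\|_u)$ at the new point $u$ (where $C$ stands for the functional $v\mapsto\langle C,v\rangle$ on $E$, and $1/0:=0$), and pass to stage 2. * Stage 2. Replace $\eta$ by $\bigl(1+\tfrac1{8\sqrt\vartheta}\bigr)\eta$ and make a Newton step for $\tilde\sigma+\eta\langle C,\cdot\rangle$. (If $E=\{0\}$, the method stays at the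 only point of $U(P)$.) Let $X_N$ be the tensor reached after $N$ iterations. There is an absolute constant $A>0$, independent of $d,n_1,\dots,n_d,P,C,K,\ell,\vartheta,\varepsilon$, such that for every $\varepsilon>0$ and every integer $N\ge0$ with $$N\ \ge\ A\,\sqrt{\textstyle\prod_{k=1}^d n_k}\;\log\Bigl(\sqrt2\,\varepsilon^{-1}K^{-d}\textstyle\prod_{k=1}^d n_k^{1+\ell}\Bigr)$$ the tensor $X_N$ lies in $U(P)$, has positive entries and gives the value $\tau(C,P)$ within relative precision $\varepsilon$: $$|\langle C,X_N\rangle-\tau|\le\varepsilon\,(T-\tau).$$ In particular, if $n_1=\cdots=n_d=n$, the same holds for every integer $N\ge0$ with $N\ge A\,n^{d/2}\log\bigl(\sqrt2\,\varepsilon^{-1}K^{-d}n^{d(1+\ell)}\bigr)$. -/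

import Mathlib

open scoped ENNReal NNReal

noncomputable section

namespace TensorOT

/-! ### Complexity value and the short-step interior point method in a normed space -/

section General

variable {E : Type*} [NormedAddCommGroup E] [NormedSpace ℝ E]

/-- The Hessian `∂²f(x)`, as the map `u ↦ (v ↦ D²f(x)[u, v])`. -/
def hessian (f : E → ℝ) (x : E) : E →L[ℝ] (E →L[ℝ] ℝ) := fderiv ℝ (fderiv ℝ f) x

/-- The complexity value `θ(f) ∈ [0, ∞]` of a (standard) self-concordant function `f` on `D`:
the supremum over `x ∈ D` of the infimum of the `t = λ²` such that
`|∇f(x)ᵀ u|² ≤ t · uᵀ ∂²f(x) u` for all `u` (the infimum is `∞` if there is no such finite `t`). -/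
def complexityValue (f : E → ℝ) (D : Set E) : ℝ≥0∞ :=
  ⨆ x ∈ D, ⨅ (t : ℝ≥0) (_ : ∀ u : E, (fderiv ℝ f x u) ^ 2 ≤ (t : ℝ) * hessian f x u u), (t : ℝ≥0∞)

/-- The local norm `‖u‖_x = (uᵀ ∂²f(x) u)^{1/2}`. -/
def localNorm (f : E → ℝ) (x u : E) : ℝ := √(hessian f x u u)

/-- The Newton step at `x` for the function `f + w`, where `w` is a linear functional:
`-(∂²f(x))⁻¹ (∇f(x) + w)`. -/
def newtonStep (f : E → ℝ) (w : E →L[ℝ] ℝ) (x : E) : E :=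
  -((hessian f x).inverse (fderiv ℝ f x + w))

/-- The two stages of the method: following the auxiliary central path from the starting point
to the analytic centre, and following the central path of the optimization problem. -/
inductive Phase
  | centering
  | main

/-- The data carried by the method between two iterations: the stage, the current point and the
current path parameter (`ν` in the first stage, `η` in the second one). -/
structure State (E : Type*) where
  phase : Phase
  point : E
  param : ℝ

open Classical in
/-- One iteration (exactly one Newton step) of the short-step path-following method for minimizing
the linear functional `c` over the domain of the barrier `f`, with starting point `x₀` and
barrier parameter `ϑ`.

* First stage: `x₀` is the point with parameter `ν = 1` of the path of minimizers of
  `f - ν Df(x₀)`. Multiply `ν` by `1 - 1/(8√ϑ)` and make a Newton step for `f - ν Df(x₀)`.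
  As soon as the Newton step for `f` itself has local norm at most `1/7`, make this step instead,
  put `η = 1/(12 ‖∂²f(y)⁻¹ c‖_y)` at the new point `y` and enter the second stage.
* Second stage: multiply `η` by `1 + 1/(8√ϑ)` and make a Newton step for `f + η c`. -/
def shortStep (f : E → ℝ) (c : E →L[ℝ] ℝ) (x₀ : E) (ϑ : ℝ) (s : State E) : State E :=
  match s.phase with
  | Phase.centering =>
    if localNorm f s.point (newtonStep f 0 s.point) ≤ 1 / 7 then
      let y := s.point + newtonStep f 0 s.point
      { phase := Phase.main
        point := y
        param := 1 / (12 * localNorm f y ((hessian f y).inverse c)) }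
    else
      let ν := (1 - 1 / (8 * √ϑ)) * s.param
      { phase := Phase.centering
        point := s.point + newtonStep f (-(ν • fderiv ℝ f x₀)) s.point
        param := ν }
  | Phase.main =>
      let η := (1 + 1 / (8 * √ϑ)) * s.param
      { phase := Phase.main
        point := s.point + newtonStep f (η • c) s.point
        param := η }

/-- The point reached by the short-step method from `x₀` after `N` iterations. -/
def shortStepIterate (f : E → ℝ) (c : E →L[ℝ] ℝ) (x₀ : E) (ϑ : ℝ) (N : ℕ) : E :=
  ((shortStep f c x₀ ϑ)^[N] { phase := Phase.centering, point := x₀, param := 1 }).point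

end General

/-! ### The tensor optimal transport problem -/

/-- Real tensors of format `n₁ × ⋯ × n_d`, with the Hilbert-Schmidt inner product. -/
abbrev Tensor {d : ℕ} (n : Fin d → ℕ) : Type := EuclideanSpace ℝ ((k : Fin d) → Fin (n k))

variable {d : ℕ} {n : Fin d → ℕ}

/-- The `i`-th entry of the `k`-th marginal: the sum of all entries whose `k`-th index is `i`. -/
def marginal (X : Tensor n) (k : Fin d) (i : Fin (n k)) : ℝ :=
  ∑ j : (k : Fin d) → Fin (n k), if j k = i then X j else 0

/-- The transport polytope `U(P)`: nonnegative tensors with marginals `p₁, …, p_d`. -/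
def polytope (p : (k : Fin d) → Fin (n k) → ℝ) : Set (Tensor n) :=
  {X | (∀ j, 0 ≤ X j) ∧ ∀ k i, marginal X k i = p k i}

/-- The optimal value `τ(C, P)`, the minimum of `⟨C, U⟩` over `U(P)`. -/
def optValue (C : Tensor n) (p : (k : Fin d) → Fin (n k) → ℝ) : ℝ :=
  sInf ((fun U : Tensor n => inner ℝ C U) '' polytope p)

/-- The maximum of `⟨C, U⟩` over `U(P)`. -/
def maxValue (C : Tensor n) (p : (k : Fin d) → Fin (n k) → ℝ) : ℝ :=
  sSup ((fun U : Tensor n => inner ℝ C U) '' polytope p)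

/-- The tensor `p₁ ⊗ ⋯ ⊗ p_d`. -/
def productTensor (p : (k : Fin d) → Fin (n k) → ℝ) : Tensor n :=
  WithLp.toLp 2 fun j => ∏ k, p k (j k)

/-- The linear space `U_{0,d}` of tensors all of whose marginals vanish. -/
def zeroMarginals (n : Fin d → ℕ) : Submodule ℝ (Tensor n) where
  carrier := {X | ∀ k i, marginal X k i = 0}
  zero_mem' := by
    intro k i
    simp [marginal]
  add_mem' := by
    intro X Y hX hY k i
    have h : marginal (X + Y) k i = marginal X k i + marginal Y k i := by
      simp only [marginal, ← Finset.sum_add_distrib]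
      refine Finset.sum_congr rfl fun j _ => ?_
      split_ifs <;> simp
    rw [h, hX k i, hY k i, add_zero]
  smul_mem' := by
    intro a X hX k i
    have h : marginal (a • X) k i = a * marginal X k i := by
      simp only [marginal, Finset.mul_sum]
      refine Finset.sum_congr rfl fun j _ => ?_
      split_ifs <;> simp
    rw [h, hX k i, mul_zero]

/-- The logarithmic barrier `σ(X) = -∑ log x_{i₁,…,i_d}` of the positive orthant. -/
def logBarrier (X : Tensor n) : ℝ := -∑ j, Real.log (X j)

/-- The restriction of `σ` to the affine space `p₁ ⊗ ⋯ ⊗ p_d + U_{0,d}`, as a function of the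
displacement from `p₁ ⊗ ⋯ ⊗ p_d`. -/
def restrictedBarrier (p : (k : Fin d) → Fin (n k) → ℝ) (u : zeroMarginals n) : ℝ :=
  logBarrier (productTensor p + (u : Tensor n))

/-- The domain of the restricted barrier: the displacements leading to positive tensors, that is,
the interior of `U(P)` relative to the affine space `p₁ ⊗ ⋯ ⊗ p_d + U_{0,d}`. -/
def barrierDomain (p : (k : Fin d) → Fin (n k) → ℝ) : Set (zeroMarginals n) :=
  {u | ∀ j, 0 < (productTensor p + (u : Tensor n)) j}

/-- The linear functional `u ↦ ⟨C, u⟩` on `U_{0,d}`. -/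
def objective (C : Tensor n) : zeroMarginals n →L[ℝ] ℝ :=
  (innerSL ℝ C).comp (zeroMarginals n).subtypeL

/-- The tensor reached after `N` iterations by the short-step method with the restricted barrier,
objective `⟨C, ·⟩` and barrier parameter `ϑ`, started at `p₁ ⊗ ⋯ ⊗ p_d` (displacement `0`). -/
def ipmIterate (C : Tensor n) (p : (k : Fin d) → Fin (n k) → ℝ) (ϑ : ℝ) (N : ℕ) : Tensor n :=
  productTensor p +
    (shortStepIterate (restrictedBarrier p) (objective C) 0 ϑ N : zeroMarginals n)

/-- A strictly feasible tensor `X` whose cost gives `τ(C, P)` within precision `ε`, measured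
relative to the range `max ⟨C, U⟩ - min ⟨C, U⟩` of the cost over `U(P)`. -/
def FindsValue (C : Tensor n) (p : (k : Fin d) → Fin (n k) → ℝ) (ε : ℝ) (X : Tensor n) : Prop :=
  X ∈ polytope p ∧ (∀ j, 0 < X j) ∧
    |inner ℝ C X - optValue C p| ≤ ε * (maxValue C p - optValue C p)

/-- A probability vector `q ∈ ℝ^m` is a weak `K`-`ℓ` uniform distribution if `q_j ≥ K / m^ℓ` for
all `j`, where `K > 0`, `ℓ ≥ 1` and `K ≤ m^{ℓ-1}`. -/
structure IsWeakUniform {m : ℕ} (K ℓ : ℝ) (q : Fin m → ℝ) : Prop where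
  nonneg : ∀ j, 0 ≤ q j
  sum_eq_one : ∑ j, q j = 1
  K_pos : 0 < K
  one_le : 1 ≤ ℓ
  K_le : K ≤ (m : ℝ) ^ (ℓ - 1)
  lower : ∀ j, K / (m : ℝ) ^ ℓ ≤ q j

end TensorOT

end

noncomputable section

namespace TensorOT

open Filter Topology

/-! ### The derivatives of the logarithmic barrier of a polyhedron -/

section Polyhedron

variable {ι V : Type*} [Fintype ι] [NormedAddCommGroup V] [NormedSpace ℝ V]
  {s : ι → V → ℝ} {L : ι → V →L[ℝ] ℝ}

/-! In slack coordinates the Hessian of the barrier at `x = x₀ + u` is `∑ (v_j/x_j)(w_j/x_j)`, so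
the local norm of `h` is the Euclidean norm of the ratios `h_j/x_j`, and the estimates reduce to
Cauchy–Schwarz. Distance to a central path is measured by the Newton decrement, the dual local norm
of the current gradient, always through upper bounds (`DualBound`). A full Newton step turns a
decrement bound `b < 1` into `b²` (`newtonStep_quadratic`). The barrier gradient has dual norm at
most `√ϑ`, so rescaling the path parameter by `1 ± 1/(8√ϑ)` raises the decrement from `1/9` to at
most `1/4` (`DualBound.rescale`), and the step brings it down to `1/16`. This keeps the invariant
`Tracks`.

The rest is counting. Feasible tensors have total mass one and the entries of `x₀` are at least `ρ =
∏ K/n_k^ℓ`, so the gradient at the start has dual norm at most `ρ⁻¹` everywhere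
(`dualBound_fderiv_zero`); since `ν` decays geometrically, the first stage ends after `O(√ϑ log
ρ⁻¹)` steps, up to an additive constant. The unit local ball is symmetric and feasible, so the
objective has dual norm at most half its range (`localNorm_inverse_le_of_range`) and, unless it is
constant, `η` starts at no less than `1/(6 · range)`. Near the path, `η` times the gap is at most
`2M` with `M = ∏ n_k` (`DualBound.objective_gap`), so growth of `η` by `12M/ε` suffices.
`iteration_count` adds the two stages. -/

lemma hasFDerivAt_neg_sum_log (hs : ∀ j y, HasFDerivAt (s j) (L j) y) {u : V}
    (hu : ∀ j, 0 < s j u) :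
    HasFDerivAt (fun y => -∑ j, Real.log (s j y)) (-∑ j, (s j u)⁻¹ • L j) u :=
  (HasFDerivAt.fun_sum fun j _ => (hs j u).log (hu j).ne').fun_neg

lemma fderiv_neg_sum_log (hs : ∀ j y, HasFDerivAt (s j) (L j) y) {u : V}
    (hu : ∀ j, 0 < s j u) (v : V) :
    fderiv ℝ (fun y => -∑ j, Real.log (s j y)) u v = -∑ j, L j v / s j u := by
  rw [(hasFDerivAt_neg_sum_log hs hu).fderiv]
  simp [div_eq_inv_mul]

lemma hessian_neg_sum_log (hs : ∀ j y, HasFDerivAt (s j) (L j) y) {u : V}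
    (hu : ∀ j, 0 < s j u) (v w : V) :
    hessian (fun y => -∑ j, Real.log (s j y)) u v w =
      ∑ j, (L j v / s j u) * (L j w / s j u) := by
  have hpos : ∀ᶠ y in 𝓝 u, ∀ j, 0 < s j y :=
    eventually_all.2 fun j => (hs j u).continuousAt.eventually (lt_mem_nhds (hu j))
  -- The gradient formula needs positive slacks, so it is only available near `u`; that is enough to
  -- differentiate it there.
  have heq : fderiv ℝ (fun y => -∑ j, Real.log (s j y)) =ᶠ[𝓝 u]
      fun y => -∑ j, (s j y)⁻¹ • L j := by
    filter_upwards [hpos] with y hy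
    exact (hasFDerivAt_neg_sum_log hs hy).fderiv
  have hder : HasFDerivAt (fun y => -∑ j, (s j y)⁻¹ • L j)
      (-∑ j, (-(s j u ^ 2)⁻¹ • L j).smulRight (L j)) u :=
    HasFDerivAt.fun_neg (HasFDerivAt.fun_sum (F := V →L[ℝ] ℝ) fun j _ =>
      ((hasDerivAt_inv (hu j).ne').comp_hasFDerivAt u (hs j u)).smul_const (L j))
  unfold hessian
  rw [heq.fderiv_eq, hder.fderiv]
  simp only [neg_apply, sum_apply, ContinuousLinearMap.smulRight_apply, smul_apply,
    smul_eq_mul, ← Finset.sum_neg_distrib]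
  refine Finset.sum_congr rfl fun j _ => ?_
  have := (hu j).ne'
  field_simp

end Polyhedron

/-! ### The logarithmic barrier of a slice of the positive orthant -/

section Slice

variable {ι : Type*} {E : Submodule ℝ (EuclideanSpace ℝ ι)} {x₀ : EuclideanSpace ℝ ι}

/-- The `j`-th coordinate functional on `E`. -/
def coordOn (E : Submodule ℝ (EuclideanSpace ℝ ι)) (j : ι) : E →L[ℝ] ℝ :=
  (EuclideanSpace.proj j).comp E.subtypeL

variable [Fintype ι]

/-- The logarithmic barrier of the slice of the positive orthant by `x₀ + E`, as a function of the
displacement from `x₀`. -/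
def sliceBarrier (E : Submodule ℝ (EuclideanSpace ℝ ι)) (x₀ : EuclideanSpace ℝ ι) (u : E) : ℝ :=
  -∑ j, Real.log ((x₀ + (u : EuclideanSpace ℝ ι)) j)

/-- The displacements in `E` that lead from `x₀` to entrywise positive vectors. -/
def sliceDomain (E : Submodule ℝ (EuclideanSpace ℝ ι)) (x₀ : EuclideanSpace ℝ ι) : Set E :=
  {u | ∀ j, 0 < (x₀ + (u : EuclideanSpace ℝ ι)) j}

/-- The norm of `h` relative to the vector `x₀ + u`. -/
def relNorm (x₀ : EuclideanSpace ℝ ι) (u h : E) : ℝ :=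
  √(∑ j, ((h : EuclideanSpace ℝ ι) j / (x₀ + (u : EuclideanSpace ℝ ι)) j) ^ 2)

lemma relNorm_nonneg (u h : E) : 0 ≤ relNorm x₀ u h := Real.sqrt_nonneg _

lemma relNorm_sq (u h : E) : relNorm x₀ u h ^ 2 =
    ∑ j, ((h : EuclideanSpace ℝ ι) j / (x₀ + (u : EuclideanSpace ℝ ι)) j) ^ 2 :=
  Real.sq_sqrt (Finset.sum_nonneg fun _ _ => sq_nonneg _)

lemma abs_div_le_relNorm (u h : E) (j : ι) :
    |(h : EuclideanSpace ℝ ι) j / (x₀ + (u : EuclideanSpace ℝ ι)) j| ≤ relNorm x₀ u h :=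
  Real.abs_le_sqrt (Finset.single_le_sum
    (f := fun j => ((h : EuclideanSpace ℝ ι) j / (x₀ + (u : EuclideanSpace ℝ ι)) j) ^ 2)
    (fun _ _ => sq_nonneg _) (Finset.mem_univ j))

lemma abs_sum_mul_le (a b : ι → ℝ) :
    |∑ j, a j * b j| ≤ √(∑ j, a j ^ 2) * √(∑ j, b j ^ 2) := by
  rw [← Real.sqrt_mul (Finset.sum_nonneg fun _ _ => sq_nonneg _)]
  exact Real.abs_le_sqrt (Finset.sum_mul_sq_le_sq_mul_sq _ _ _)

lemma hasFDerivAt_coord (j : ι) (u : E) :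
    HasFDerivAt (fun u : E => (x₀ + (u : EuclideanSpace ℝ ι)) j) (coordOn E j) u :=
  (coordOn E j).hasFDerivAt.const_add (x₀ j)

lemma fderiv_sliceBarrier {u : E} (hu : u ∈ sliceDomain E x₀) (v : E) :
    fderiv ℝ (sliceBarrier E x₀) u v =
      -∑ j, (v : EuclideanSpace ℝ ι) j / (x₀ + (u : EuclideanSpace ℝ ι)) j :=
  fderiv_neg_sum_log (s := fun j (u : E) => (x₀ + (u : EuclideanSpace ℝ ι)) j) (L := coordOn E)
    hasFDerivAt_coord hu v

lemma hessian_sliceBarrier {u : E} (hu : u ∈ sliceDomain E x₀) (v w : E) :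
    hessian (sliceBarrier E x₀) u v w =
      ∑ j, ((v : EuclideanSpace ℝ ι) j / (x₀ + (u : EuclideanSpace ℝ ι)) j) *
        ((w : EuclideanSpace ℝ ι) j / (x₀ + (u : EuclideanSpace ℝ ι)) j) :=
  hessian_neg_sum_log (s := fun j (u : E) => (x₀ + (u : EuclideanSpace ℝ ι)) j) (L := coordOn E)
    hasFDerivAt_coord hu v w

lemma hessian_self {u : E} (hu : u ∈ sliceDomain E x₀) (v : E) :
    hessian (sliceBarrier E x₀) u v v = relNorm x₀ u v ^ 2 := by
  rw [hessian_sliceBarrier hu, relNorm_sq]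
  exact Finset.sum_congr rfl fun j _ => (sq _).symm

lemma localNorm_sliceBarrier {u : E} (hu : u ∈ sliceDomain E x₀) (v : E) :
    localNorm (sliceBarrier E x₀) u v = relNorm x₀ u v := by
  rw [localNorm, hessian_self hu, Real.sqrt_sq (relNorm_nonneg _ _)]

lemma abs_hessian_le {u : E} (hu : u ∈ sliceDomain E x₀) (v w : E) :
    |hessian (sliceBarrier E x₀) u v w| ≤ relNorm x₀ u v * relNorm x₀ u w := by
  rw [hessian_sliceBarrier hu]
  exact abs_sum_mul_le _ _

lemma eq_zero_of_relNorm_eq_zero {u h : E} (hu : u ∈ sliceDomain E x₀)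
    (h0 : relNorm x₀ u h = 0) : h = 0 := by
  ext j
  have := abs_div_le_relNorm (x₀ := x₀) u h j
  rw [h0, abs_nonpos_iff, div_eq_zero_iff] at this
  exact this.resolve_right (hu j).ne'

/-- Definiteness gives injectivity, and `E` and its dual have the same finite dimension. Without
this, `inverse` in `newtonStep` would be the default value `0`. -/
lemma isInvertible_hessian {u : E} (hu : u ∈ sliceDomain E x₀) :
    (hessian (sliceBarrier E x₀) u).IsInvertible := by
  have hinj : Function.Injective (hessian (sliceBarrier E x₀) u) := by
    refine (injective_iff_map_eq_zero _).2 fun v hv => ?_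
    have h0 : relNorm x₀ u v ^ 2 = 0 := by
      rw [← hessian_self hu, hv, zero_apply]
    exact eq_zero_of_relNorm_eq_zero hu (pow_eq_zero_iff two_ne_zero |>.1 h0)
  have hdim : Module.finrank ℝ E = Module.finrank ℝ (E →L[ℝ] ℝ) := by
    rw [← LinearEquiv.finrank_eq (LinearMap.toContinuousLinearMap (𝕜 := ℝ) (E := E) (F' := ℝ)),
      ← Subspace.dual_finrank_eq (K := ℝ) (V := E)]
  exact ⟨(LinearEquiv.ofInjectiveOfFinrankEq
    (hessian (sliceBarrier E x₀) u : E →ₗ[ℝ] (E →L[ℝ] ℝ)) hinj hdim).toContinuousLinearEquiv, rfl⟩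

/-- `b` bounds the norm of the functional `w` dual to the local norm at `u`. -/
def DualBound (x₀ : EuclideanSpace ℝ ι) (u : E) (w : E →L[ℝ] ℝ) (b : ℝ) : Prop :=
  ∀ h : E, |w h| ≤ b * relNorm x₀ u h

lemma DualBound.mono {u : E} {w : E →L[ℝ] ℝ} {a b : ℝ} (hw : DualBound x₀ u w a) (hab : a ≤ b) :
    DualBound x₀ u w b := fun h =>
  (hw h).trans (mul_le_mul_of_nonneg_right hab (relNorm_nonneg _ _))

lemma DualBound.add {u : E} {w z : E →L[ℝ] ℝ} {a b : ℝ} (hw : DualBound x₀ u w a)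
    (hz : DualBound x₀ u z b) : DualBound x₀ u (w + z) (a + b) := fun h => by
  rw [add_mul]
  exact (abs_add_le _ _).trans (add_le_add (hw h) (hz h))

lemma DualBound.smul {u : E} {w : E →L[ℝ] ℝ} {b : ℝ} (hw : DualBound x₀ u w b) (t : ℝ) :
    DualBound x₀ u (t • w) (|t| * b) := fun h => by
  rw [smul_apply, smul_eq_mul, abs_mul, mul_assoc]
  exact mul_le_mul_of_nonneg_left (hw h) (abs_nonneg t)

/-- Cauchy–Schwarz for the Hessian form. Together with `DualBound.localNorm_inverse_le`, which tests
`w` on `H⁻¹w` itself, it identifies the local norm of `H⁻¹w` with the dual norm of `w`. -/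
lemma dualBound_localNorm_inverse {u : E} (hu : u ∈ sliceDomain E x₀) (w : E →L[ℝ] ℝ) :
    DualBound x₀ u w (localNorm (sliceBarrier E x₀) u ((hessian (sliceBarrier E x₀) u).inverse w)) :=
  fun h => by
    have := abs_hessian_le hu ((hessian (sliceBarrier E x₀) u).inverse w) h
    rwa [(isInvertible_hessian hu).self_apply_inverse, ← localNorm_sliceBarrier hu] at this

lemma DualBound.localNorm_inverse_le {u : E} (hu : u ∈ sliceDomain E x₀) {w : E →L[ℝ] ℝ} {b : ℝ}
    (hb : 0 ≤ b) (hw : DualBound x₀ u w b) :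
    localNorm (sliceBarrier E x₀) u ((hessian (sliceBarrier E x₀) u).inverse w) ≤ b := by
  set v := (hessian (sliceBarrier E x₀) u).inverse w with hv
  rw [localNorm_sliceBarrier hu]
  have h1 : relNorm x₀ u v ^ 2 = w v := by
    rw [← hessian_self hu, hv, (isInvertible_hessian hu).self_apply_inverse]
  have h2 := (le_abs_self _).trans (hw v)
  rw [← h1, sq] at h2
  by_contra! hlt
  exact (h2.trans_lt (mul_lt_mul_of_pos_right hlt (hb.trans_lt hlt))).false

lemma newtonStep_eq (f : E → ℝ) (w : E →L[ℝ] ℝ) (u : E) :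
    newtonStep f w u = -((hessian f u).inverse (fderiv ℝ f u + w)) := rfl

lemma localNorm_neg {u : E} (hu : u ∈ sliceDomain E x₀) (v : E) :
    localNorm (sliceBarrier E x₀) u (-v) = localNorm (sliceBarrier E x₀) u v := by
  simp [localNorm_sliceBarrier hu, relNorm, neg_div]

lemma add_mem_sliceDomain {u v : E} (hu : u ∈ sliceDomain E x₀) (hv : relNorm x₀ u v < 1) :
    u + v ∈ sliceDomain E x₀ := fun j => by
  have h1 := (abs_lt.1 ((abs_div_le_relNorm (x₀ := x₀) u v j).trans_lt hv)).1
  rw [lt_div_iff₀ (hu j)] at h1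
  have : (x₀ + ((u + v : E) : EuclideanSpace ℝ ι)) j =
      (x₀ + (u : EuclideanSpace ℝ ι)) j + (v : EuclideanSpace ℝ ι) j := by
    simp [add_assoc]
  rw [this]
  linarith

/-- Quadratic convergence of Newton's method for the barrier plus a linear functional. -/
lemma newtonStep_quadratic {u : E} (hu : u ∈ sliceDomain E x₀) {w : E →L[ℝ] ℝ} {b : ℝ}
    (hb : 0 ≤ b) (hb1 : b < 1) (hw : DualBound x₀ u (fderiv ℝ (sliceBarrier E x₀) u + w) b) :
    u + newtonStep (sliceBarrier E x₀) w u ∈ sliceDomain E x₀ ∧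
      DualBound x₀ (u + newtonStep (sliceBarrier E x₀) w u)
        (fderiv ℝ (sliceBarrier E x₀) (u + newtonStep (sliceBarrier E x₀) w u) + w) (b ^ 2) := by
  set v := newtonStep (sliceBarrier E x₀) w u with hv
  have hvb : relNorm x₀ u v ≤ b := by
    rw [← localNorm_sliceBarrier hu, hv, newtonStep_eq, localNorm_neg hu]
    exact hw.localNorm_inverse_le hu hb
  have hmem := add_mem_sliceDomain hu (hvb.trans_lt hb1)
  refine ⟨hmem, fun h => ?_⟩
  have hnewton : w h = -fderiv ℝ (sliceBarrier E x₀) u h - hessian (sliceBarrier E x₀) u v h := by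
    rw [hv, newtonStep_eq, map_neg, (isInvertible_hessian hu).self_apply_inverse]
    simp
  -- After eliminating `w` by the Newton equation, this is `1/x - 1/(x+v) - v/x² = -v²/(x²(x+v))` in
  -- each coordinate. Ratios of `h` are taken at the new point, so no change-of-norm factor is lost.
  have key : (fderiv ℝ (sliceBarrier E x₀) (u + v) + w) h =
      -∑ j, ((h : EuclideanSpace ℝ ι) j / (x₀ + ((u + v : E) : EuclideanSpace ℝ ι)) j) *
        ((v : EuclideanSpace ℝ ι) j / (x₀ + (u : EuclideanSpace ℝ ι)) j) ^ 2 := by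
    rw [add_apply, hnewton, fderiv_sliceBarrier hu, fderiv_sliceBarrier hmem,
      hessian_sliceBarrier hu, neg_neg, ← Finset.sum_neg_distrib, ← Finset.sum_neg_distrib,
      ← Finset.sum_sub_distrib, ← Finset.sum_add_distrib]
    refine Finset.sum_congr rfl fun j _ => ?_
    have h1 := (hu j).ne'
    have h2 := (hmem j).ne'
    have h3 : (x₀ + ((u + v : E) : EuclideanSpace ℝ ι)) j =
        (x₀ + (u : EuclideanSpace ℝ ι)) j + (v : EuclideanSpace ℝ ι) j := by
      simp [add_assoc]
    rw [h3] at h2 ⊢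
    field_simp
    ring
  rw [key, abs_neg]
  refine (abs_sum_mul_le _ _).trans ?_
  rw [mul_comm]
  refine mul_le_mul_of_nonneg_right ?_ (Real.sqrt_nonneg _)
  have hsq : relNorm x₀ u v ^ 2 ≤ b ^ 2 :=
    pow_le_pow_left₀ (relNorm_nonneg _ _) hvb 2
  -- The sum of fourth powers of the ratios is at most the square of the sum of their squares.
  refine Real.sqrt_le_iff.2 ⟨sq_nonneg b, ?_⟩
  calc _ ≤ (∑ j, ((v : EuclideanSpace ℝ ι) j / (x₀ + (u : EuclideanSpace ℝ ι)) j) ^ 2) ^ 2 :=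
        Finset.sum_sq_le_sq_sum_of_nonneg fun _ _ => sq_nonneg _
    _ ≤ _ := by
      rw [← relNorm_sq]
      exact pow_le_pow_left₀ (sq_nonneg _) hsq 2

/-! ### The complexity value -/

lemma fderiv_sq_le {u : E} (hu : u ∈ sliceDomain E x₀) (v : E) :
    (fderiv ℝ (sliceBarrier E x₀) u v) ^ 2 ≤ Fintype.card ι * relNorm x₀ u v ^ 2 := by
  rw [fderiv_sliceBarrier hu, neg_sq, relNorm_sq]
  exact sq_sum_le_card_mul_sum_sq

lemma complexityValue_sliceBarrier_le :
    complexityValue (sliceBarrier E x₀) (sliceDomain E x₀) ≤ Fintype.card ι := by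
  refine iSup₂_le fun u hu => ?_
  refine (iInf₂_le (Fintype.card ι : ℝ≥0) fun v => ?_).trans (by simp)
  rw [hessian_self hu, NNReal.coe_natCast]
  exact fderiv_sq_le hu v

/-- The infimum in `complexityValue` is not known to be attained, so the bound is shown for every `r
> ϑ` and passed to the limit. The `max` reflects the truncation in `ENNReal.ofReal`. -/
lemma fderiv_sq_le_of_complexityValue_le {V : Type*} [NormedAddCommGroup V] [NormedSpace ℝ V]
    {f : V → ℝ} {D : Set V} {ϑ : ℝ} (hϑ : complexityValue f D ≤ ENNReal.ofReal ϑ) {u : V}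
    (hu : u ∈ D) {v : V} (hv : 0 ≤ hessian f u v v) :
    (fderiv ℝ f u v) ^ 2 ≤ max ϑ 0 * hessian f u v v := by
  have key : ∀ r : ℝ≥0, ϑ.toNNReal < r → (fderiv ℝ f u v) ^ 2 ≤ r * hessian f u v v := by
    intro r hr
    have h1 : (⨅ (t : ℝ≥0) (_ : ∀ v : V, (fderiv ℝ f u v) ^ 2 ≤ (t : ℝ) * hessian f u v v),
        (t : ℝ≥0∞)) < r :=
      ((le_iSup₂ (f := fun x (_ : x ∈ D) => ⨅ (t : ℝ≥0)
        (_ : ∀ v : V, (fderiv ℝ f x v) ^ 2 ≤ (t : ℝ) * hessian f x v v), (t : ℝ≥0∞))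
        u hu).trans hϑ).trans_lt (ENNReal.coe_lt_coe.2 hr)
    simp only [iInf_lt_iff] at h1
    obtain ⟨t, ht, htr⟩ := h1
    exact (ht v).trans (mul_le_mul_of_nonneg_right
      (NNReal.coe_le_coe.2 (ENNReal.coe_lt_coe.1 htr).le) hv)
  rw [← Real.coe_toNNReal']
  have hlim : Tendsto (fun n : ℕ => ((ϑ.toNNReal : ℝ) + 1 / ((n : ℝ) + 1)) * hessian f u v v) atTop
      (𝓝 (((ϑ.toNNReal : ℝ) + 0) * hessian f u v v)) :=
    (tendsto_const_nhds.add tendsto_one_div_add_atTop_nhds_zero_nat).mul_const _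
  rw [add_zero] at hlim
  refine ge_of_tendsto' hlim fun n => ?_
  have := key (ϑ.toNNReal + 1 / ((n : ℝ≥0) + 1)) (lt_add_of_pos_right _ (by positivity))
  simpa using this

/-- A lower bound for the barrier parameter, found by approaching the boundary along a line. -/
lemma one_le_of_fderiv_sq_le (hx₀ : ∀ j, 0 < x₀ j) {ϑ : ℝ} {v : E} {j₀ : ι}
    (hj₀ : (v : EuclideanSpace ℝ ι) j₀ < 0)
    (h : ∀ u ∈ sliceDomain E x₀, (fderiv ℝ (sliceBarrier E x₀) u v) ^ 2 ≤ ϑ * relNorm x₀ u v ^ 2) :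
    1 ≤ ϑ := by
  classical
  let S : Finset ι := {j | (v : EuclideanSpace ℝ ι) j < 0}
  have hS : S.Nonempty := ⟨j₀, by simp [S, hj₀]⟩
  obtain ⟨j₁, hj₁, hmin⟩ := S.exists_min_image (fun j => x₀ j / -(v : EuclideanSpace ℝ ι) j) hS
  have hv₁ : (v : EuclideanSpace ℝ ι) j₁ < 0 := by simpa [S] using hj₁
  -- The time at which the ray `x₀ + t v` leaves the orthant; `y` is the exit point.
  set t := x₀ j₁ / -(v : EuclideanSpace ℝ ι) j₁ with ht
  have htpos : 0 < t := div_pos (hx₀ j₁) (neg_pos.2 hv₁)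
  set y : ι → ℝ := fun j => x₀ j + t * (v : EuclideanSpace ℝ ι) j with hy
  have hy0 : ∀ j, 0 ≤ y j := by
    intro j
    rcases lt_or_ge ((v : EuclideanSpace ℝ ι) j) 0 with hj | hj
    · have := hmin j (by simp [S, hj])
      rw [le_div_iff₀ (neg_pos.2 hj)] at this
      simp only [hy]
      linarith
    · exact add_nonneg (hx₀ j).le (mul_nonneg htpos.le hj)
  have hy1 : y j₁ = 0 := by
    simp only [hy, ht]
    field_simp [hv₁.ne]
    ring
  have hyv : ∀ j, y j = 0 → (v : EuclideanSpace ℝ ι) j < 0 := by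
    intro j hj
    by_contra! hc
    have : 0 < y j := add_pos_of_pos_of_nonneg (hx₀ j) (mul_nonneg htpos.le hc)
    exact this.ne' hj
  let F : Finset ι := {j | y j = 0}
  -- the ratios of `v` to the slacks, scaled by the distance to the boundary
  let r : ℝ → ι → ℝ := fun s j =>
    s * (v : EuclideanSpace ℝ ι) j / (y j - s * (v : EuclideanSpace ℝ ι) j)
  -- Slacks vanishing at `y` contribute ratio `-1` at every distance `s`; the others die out after
  -- scaling by `s`.
  have hr : ∀ j, Tendsto (fun s => r s j) (𝓝[>] 0) (𝓝 (if y j = 0 then -1 else 0)) := by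
    intro j
    split_ifs with hj
    · refine tendsto_const_nhds.congr' ?_
      filter_upwards [self_mem_nhdsWithin] with s hs
      have h1 : s ≠ 0 := (Set.mem_Ioi.1 hs).ne'
      have h2 := (hyv j hj).ne
      simp only [r, hj]
      field_simp
      simp
    · have hc : ContinuousAt (fun s => r s j) 0 := by
        refine ContinuousAt.div (by fun_prop) (by fun_prop) (by simpa using hj)
      have := hc.tendsto
      simp only [r, zero_mul, sub_zero, zero_div] at this
      exact this.mono_left nhdsWithin_le_nhds
  have hr1 : Tendsto (fun s => (∑ j, r s j) ^ 2) (𝓝[>] 0) (𝓝 ((F.card : ℝ) ^ 2)) := by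
    have := (tendsto_finsetSum Finset.univ fun j _ => hr j).pow 2
    simpa [F, Finset.sum_ite] using this
  have hr2 : Tendsto (fun s => ϑ * ∑ j, r s j ^ 2) (𝓝[>] 0) (𝓝 (ϑ * F.card)) := by
    have := (tendsto_finsetSum Finset.univ fun j _ => (hr j).pow 2).const_mul ϑ
    simpa [F, Finset.sum_ite, ite_pow] using this
  have hle : ∀ᶠ s in 𝓝[>] (0 : ℝ), (∑ j, r s j) ^ 2 ≤ ϑ * ∑ j, r s j ^ 2 := by
    filter_upwards [Ioo_mem_nhdsGT htpos] with s hs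
    have hslack : ∀ j, (x₀ + (((t - s) • v : E) : EuclideanSpace ℝ ι)) j =
        y j - s * (v : EuclideanSpace ℝ ι) j := by
      intro j
      simp [hy]
      ring
    have hmem : (t - s) • v ∈ sliceDomain E x₀ := by
      intro j
      rw [hslack]
      rcases lt_or_ge ((v : EuclideanSpace ℝ ι) j) 0 with hj | hj
      · have := mul_pos_of_neg_of_neg (neg_neg_of_pos hs.1) hj
        linarith [hy0 j]
      · have := mul_nonneg (sub_pos.2 hs.2).le hj
        have := hx₀ j
        simp only [hy]
        nlinarith
    have h2 := h _ hmem
    rw [fderiv_sliceBarrier hmem, relNorm_sq, neg_sq] at h2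
    simp only [hslack] at h2
    have h3 := mul_le_mul_of_nonneg_left h2 (sq_nonneg s)
    rw [← mul_pow, Finset.mul_sum, mul_left_comm, Finset.mul_sum] at h3
    simpa only [r, mul_div_assoc, mul_pow] using h3
  -- In the limit `|F|² ≤ ϑ |F|`, where `F` is the nonempty set of slacks vanishing at `y`.
  have hlim := le_of_tendsto_of_tendsto hr1 hr2 hle
  have hF : (1 : ℝ) ≤ F.card := by
    exact_mod_cast Finset.card_pos.2 ⟨j₁, by simp [F, hy1]⟩
  nlinarith

lemma one_le_of_complexityValue_le [Nontrivial E] (hx₀ : ∀ j, 0 < x₀ j) {ϑ : ℝ}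
    (hϑ : complexityValue (sliceBarrier E x₀) (sliceDomain E x₀) ≤ ENNReal.ofReal ϑ) : 1 ≤ ϑ := by
  have h : ∀ v : E, ∀ u ∈ sliceDomain E x₀,
      (fderiv ℝ (sliceBarrier E x₀) u v) ^ 2 ≤ max ϑ 0 * relNorm x₀ u v ^ 2 := by
    intro v u hu
    rw [← hessian_self hu]
    exact fderiv_sq_le_of_complexityValue_le hϑ hu (by rw [hessian_self hu]; positivity)
  have h1 : 1 ≤ max ϑ 0 := by
    obtain ⟨v, hv⟩ := exists_ne (0 : E)
    obtain ⟨j, hj⟩ : ∃ j, (v : EuclideanSpace ℝ ι) j ≠ 0 := by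
      by_contra! hc
      exact hv (by ext j; exact hc j)
    rcases hj.lt_or_gt with hj | hj
    · exact one_le_of_fderiv_sq_le hx₀ hj (h v)
    · exact one_le_of_fderiv_sq_le (v := -v) (j₀ := j) hx₀ (by simpa using hj) (h (-v))
  exact (le_max_iff.1 h1).resolve_right (by norm_num)

lemma dualBound_fderiv {ϑ : ℝ} (h1 : 1 ≤ ϑ)
    (hϑ : complexityValue (sliceBarrier E x₀) (sliceDomain E x₀) ≤ ENNReal.ofReal ϑ) {u : E}
    (hu : u ∈ sliceDomain E x₀) : DualBound x₀ u (fderiv ℝ (sliceBarrier E x₀) u) (√ϑ) := by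
  intro v
  have := fderiv_sq_le_of_complexityValue_le hϑ hu (v := v) (by rw [hessian_self hu]; positivity)
  rw [hessian_self hu, max_eq_left (by linarith)] at this
  refine (Real.abs_le_sqrt this).trans_eq ?_
  rw [Real.sqrt_mul (by linarith), Real.sqrt_sq (relNorm_nonneg _ _)]

/-! ### The short-step method follows the two central paths -/

/-- Changing the path parameter by a factor `1 + t` keeps the Newton decrement small. -/
lemma DualBound.rescale {u : E} {w : E →L[ℝ] ℝ} {ϑ t : ℝ} (hϑ : 1 ≤ ϑ)
    (hg : DualBound x₀ u (fderiv ℝ (sliceBarrier E x₀) u) (√ϑ))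
    (hw : DualBound x₀ u (fderiv ℝ (sliceBarrier E x₀) u + w) (1 / 9))
    (ht : |t| ≤ 1 / (8 * √ϑ)) :
    DualBound x₀ u (fderiv ℝ (sliceBarrier E x₀) u + (1 + t) • w) (1 / 4) := by
  have hs : 1 ≤ √ϑ := Real.one_le_sqrt.2 hϑ
  have h1 : |t| * √ϑ ≤ 1 / 8 := by
    calc |t| * √ϑ ≤ 1 / (8 * √ϑ) * √ϑ := by gcongr
      _ = 1 / 8 := by field_simp
  have h2 : |t| ≤ 1 / 8 := (le_mul_of_one_le_right (abs_nonneg t) hs).trans h1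
  have h3 : |1 + t| ≤ 9 / 8 := (abs_add_le 1 t).trans (by rw [abs_one]; linarith)
  have key := (hw.smul (1 + t)).add (hg.smul (-t))
  have heq : (1 + t) • (fderiv ℝ (sliceBarrier E x₀) u + w) +
      (-t) • fderiv ℝ (sliceBarrier E x₀) u = fderiv ℝ (sliceBarrier E x₀) u + (1 + t) • w := by
    module
  rw [heq, abs_neg] at key
  exact key.mono (by linarith)

/-- The state after `k` iterations is close to the first central path, or it is close to the
second one, reached after at most `K₁ + 1` iterations. -/
def Tracks (x₀ : EuclideanSpace ℝ ι) (c : E →L[ℝ] ℝ) (ϑ : ℝ) (K₁ k : ℕ) (s : State E) : Prop :=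
  s.point ∈ sliceDomain E x₀ ∧
    ((s.phase = Phase.centering ∧ k ≤ K₁ ∧ s.param = (1 - 1 / (8 * √ϑ)) ^ k ∧
        DualBound x₀ s.point (fderiv ℝ (sliceBarrier E x₀) s.point +
          -(s.param • fderiv ℝ (sliceBarrier E x₀) 0)) (1 / 9)) ∨
      (s.phase = Phase.main ∧ ∃ j ≤ K₁, j + 1 ≤ k ∧ ∃ y ∈ sliceDomain E x₀,
        s.param = (1 + 1 / (8 * √ϑ)) ^ (k - (j + 1)) *
          (1 / (12 * localNorm (sliceBarrier E x₀) y ((hessian (sliceBarrier E x₀) y).inverse c))) ∧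
        DualBound x₀ s.point (fderiv ℝ (sliceBarrier E x₀) s.point + s.param • c) (1 / 9)))

lemma localNorm_newtonStep_zero_le {u : E} (hu : u ∈ sliceDomain E x₀) {b : ℝ} (hb : 0 ≤ b)
    (h : DualBound x₀ u (fderiv ℝ (sliceBarrier E x₀) u) b) :
    localNorm (sliceBarrier E x₀) u (newtonStep (sliceBarrier E x₀) 0 u) ≤ b := by
  rw [newtonStep_eq, localNorm_neg hu, add_zero]
  exact h.localNorm_inverse_le hu hb

lemma dualBound_of_localNorm_newtonStep_zero_le {u : E} (hu : u ∈ sliceDomain E x₀) {b : ℝ}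
    (h : localNorm (sliceBarrier E x₀) u (newtonStep (sliceBarrier E x₀) 0 u) ≤ b) :
    DualBound x₀ u (fderiv ℝ (sliceBarrier E x₀) u + 0) b := by
  rw [newtonStep_eq, localNorm_neg hu] at h
  exact (dualBound_localNorm_inverse hu _).mono h

/-- The thresholds fit as follows: `1/49 + 1/12 ≤ 1/9` at the change of stage, `1/9 + 2/63 = 1/7`
for leaving the first stage in time, and `(1/4)² ≤ 1/9` after an ordinary step. -/
lemma Tracks.shortStep {c : E →L[ℝ] ℝ} {ϑ R : ℝ} {K₁ k : ℕ} {s : State E} (hϑ : 1 ≤ ϑ)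
    (hg : ∀ u ∈ sliceDomain E x₀, DualBound x₀ u (fderiv ℝ (sliceBarrier E x₀) u) (√ϑ))
    (hR : ∀ u ∈ sliceDomain E x₀, DualBound x₀ u (fderiv ℝ (sliceBarrier E x₀) 0) R)
    (hK : (1 - 1 / (8 * √ϑ)) ^ K₁ * R ≤ 2 / 63) (hs : Tracks x₀ c ϑ K₁ k s) :
    Tracks x₀ c ϑ K₁ (k + 1) (shortStep (sliceBarrier E x₀) c 0 ϑ s) := by
  have hs1 : 1 ≤ √ϑ := Real.one_le_sqrt.2 hϑ
  have hδ0 : 0 < 1 / (8 * √ϑ) := by positivity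
  have hδ1 : 1 / (8 * √ϑ) ≤ 1 := by
    rw [div_le_one (by positivity)]
    linarith
  obtain ⟨phase, u, ν⟩ := s
  obtain ⟨hu, ⟨hp, hk, hν, hd⟩ | ⟨hp, j, hj, hjk, y, hy, hν, hd⟩⟩ := hs
  · simp only at hp hu hν hd
    subst hp
    by_cases hc : localNorm (sliceBarrier E x₀) u (newtonStep (sliceBarrier E x₀) 0 u) ≤ 1 / 7
    · simp only [TensorOT.shortStep, if_pos hc]
      obtain ⟨hmem, hb⟩ := newtonStep_quadratic hu (by norm_num) (by norm_num)
        (dualBound_of_localNorm_newtonStep_zero_le hu hc)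
      set y := u + newtonStep (sliceBarrier E x₀) 0 u
      refine ⟨hmem, Or.inr ⟨rfl, k, hk, le_rfl, y, hmem, by simp, ?_⟩⟩
      rw [add_zero] at hb
      set m := localNorm (sliceBarrier E x₀) y ((hessian (sliceBarrier E x₀) y).inverse c) with hm
      have hm0 : 0 ≤ m := Real.sqrt_nonneg _
      refine (hb.add ((dualBound_localNorm_inverse hmem c).smul (1 / (12 * m)))).mono ?_
      -- If the objective vanishes on `E`, then `m = 0` and the parameter is `1/0 = 0`.
      have : |1 / (12 * m)| * m ≤ 1 / 12 := by
        rw [abs_of_nonneg (by positivity)]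
        rcases hm0.eq_or_lt with h0 | h0
        · rw [← h0]; norm_num
        · refine le_of_eq ?_
          field_simp
      rw [← hm]
      linarith
    · simp only [TensorOT.shortStep, if_neg hc]
      -- At `k = K₁` the term `ν Df(0)` has dual norm at most `2/63`, so the exit test would have
      -- succeeded.
      have hlt : k + 1 ≤ K₁ := by
        refine Nat.succ_le_of_lt (lt_of_le_of_ne hk ?_)
        rintro rfl
        refine hc (localNorm_newtonStep_zero_le hu (by norm_num) ?_)
        have h1 := hd.add ((hR u hu).smul ν)
        rw [neg_add_cancel_right, hν, abs_of_nonneg (pow_nonneg (by linarith) _)] at h1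
        exact h1.mono (by linarith)
      have h1 := DualBound.rescale (t := -(1 / (8 * √ϑ))) hϑ (hg u hu) hd
        (by rw [abs_neg, abs_of_pos hδ0])
      rw [smul_neg, smul_smul, ← sub_eq_add_neg (1 : ℝ)] at h1
      obtain ⟨hmem, hb⟩ := newtonStep_quadratic hu (by norm_num) (by norm_num) h1
      refine ⟨hmem, Or.inl ⟨rfl, hlt, ?_, hb.mono (by norm_num)⟩⟩
      simp only [hν]
      ring
  · simp only at hp hu hν hd
    subst hp
    simp only [TensorOT.shortStep]
    have h1 := DualBound.rescale (t := 1 / (8 * √ϑ)) hϑ (hg u hu) hd (by rw [abs_of_pos hδ0])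
    rw [smul_smul] at h1
    obtain ⟨hmem, hb⟩ := newtonStep_quadratic hu (by norm_num) (by norm_num) h1
    refine ⟨hmem, Or.inr ⟨rfl, j, hj, by omega, y, hy, ?_, hb.mono (by norm_num)⟩⟩
    simp only [hν]
    rw [← mul_assoc, ← pow_succ', show k + 1 - (j + 1) = k - (j + 1) + 1 by omega]

lemma tracks_iterate {c : E →L[ℝ] ℝ} {ϑ R : ℝ} {K₁ : ℕ} (hx₀ : ∀ j, 0 < x₀ j) (hϑ : 1 ≤ ϑ)
    (hg : ∀ u ∈ sliceDomain E x₀, DualBound x₀ u (fderiv ℝ (sliceBarrier E x₀) u) (√ϑ))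
    (hR : ∀ u ∈ sliceDomain E x₀, DualBound x₀ u (fderiv ℝ (sliceBarrier E x₀) 0) R)
    (hK : (1 - 1 / (8 * √ϑ)) ^ K₁ * R ≤ 2 / 63) (N : ℕ) :
    Tracks x₀ c ϑ K₁ N
      ((shortStep (sliceBarrier E x₀) c 0 ϑ)^[N]
        { phase := Phase.centering, point := 0, param := 1 }) := by
  induction N with
  | zero =>
    -- With `ν = 1` at the starting point the shifted gradient is exactly zero.
    refine ⟨fun j => by simpa using hx₀ j, Or.inl ⟨rfl, Nat.zero_le _, by simp, fun h => ?_⟩⟩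
    have := relNorm_nonneg (x₀ := x₀) 0 h
    simp [this]
  | succ N ih =>
    rw [Function.iterate_succ_apply']
    exact ih.shortStep hϑ hg hR hK

/-! ### Accuracy of points close to the second central path -/

/-- With ratios `s_j = y_j/x_j`, the barrier gradient along `u - y` is `∑ s_j - M`, while the local
norm of `u - y` is at most `M + ∑ s_j`. The sums cancel, leaving `2M` with no appeal to the exact
central path. -/
lemma DualBound.objective_gap {c : E →L[ℝ] ℝ} {η : ℝ} {u y : E} (hu : u ∈ sliceDomain E x₀)
    (hy : ∀ j, 0 ≤ (x₀ + (y : EuclideanSpace ℝ ι)) j)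
    (h : DualBound x₀ u (fderiv ℝ (sliceBarrier E x₀) u + η • c) 1) :
    η * c (u - y) ≤ 2 * Fintype.card ι := by
  let s : ι → ℝ := fun j =>
    (x₀ + (y : EuclideanSpace ℝ ι)) j / (x₀ + (u : EuclideanSpace ℝ ι)) j
  have hs : ∀ j, 0 ≤ s j := fun j => div_nonneg (hy j) (hu j).le
  have hratio : ∀ j, ((u - y : E) : EuclideanSpace ℝ ι) j / (x₀ + (u : EuclideanSpace ℝ ι)) j =
      1 - s j := by
    intro j
    have := (hu j).ne'
    simp only [s]
    field_simp
    simp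
  have hgrad : fderiv ℝ (sliceBarrier E x₀) u (u - y) = ∑ j, s j - Fintype.card ι := by
    rw [fderiv_sliceBarrier hu]
    simp only [hratio, Finset.sum_sub_distrib]
    simp
  have hnorm : relNorm x₀ u (u - y) ≤ Fintype.card ι + ∑ j, s j := by
    have h0 : 0 ≤ ∑ j, s j := Finset.sum_nonneg fun j _ => hs j
    refine Real.sqrt_le_iff.2 ⟨by positivity, ?_⟩
    simp only [hratio]
    calc ∑ j, (1 - s j) ^ 2 ≤ ∑ j, (1 + s j) ^ 2 :=
          Finset.sum_le_sum fun j _ => by nlinarith [hs j]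
      _ ≤ (∑ j, (1 + s j)) ^ 2 :=
          Finset.sum_sq_le_sq_sum_of_nonneg fun j _ => by linarith [hs j]
      _ = _ := by simp [Finset.sum_add_distrib]
  have h1 := (le_abs_self _).trans (h (u - y))
  rw [add_apply, hgrad, smul_apply, smul_eq_mul, one_mul] at h1
  linarith

/-- The local norm of the objective is at most half of its range over the slice. -/
lemma localNorm_inverse_le_of_range {c : E →L[ℝ] ℝ} {a b : ℝ}
    (hc : ∀ u : E, (∀ j, 0 ≤ (x₀ + (u : EuclideanSpace ℝ ι)) j) → a ≤ c u ∧ c u ≤ b) {y : E}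
    (hy : y ∈ sliceDomain E x₀) :
    localNorm (sliceBarrier E x₀) y ((hessian (sliceBarrier E x₀) y).inverse c) ≤ (b - a) / 2 := by
  have hab : 0 ≤ (b - a) / 2 := by
    have := hc y fun j => (hy j).le
    linarith
  -- a vector of local norm at most one stays in the slice in both directions
  have key : ∀ h : E, relNorm x₀ y h ≤ 1 → c h ≤ (b - a) / 2 := by
    intro h hh
    have hj : ∀ j, |(h : EuclideanSpace ℝ ι) j| ≤ (x₀ + (y : EuclideanSpace ℝ ι)) j := by
      intro j
      have := (abs_div_le_relNorm (x₀ := x₀) y h j).trans hh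
      rwa [abs_div, abs_of_pos (hy j), div_le_one (hy j)] at this
    have h1 := (hc (y + h) fun j => by
      have := (abs_le.1 (hj j)).1
      simp only [Submodule.coe_add, PiLp.add_apply] at this ⊢
      linarith).2
    have h2 := (hc (y - h) fun j => by
      have := (abs_le.1 (hj j)).2
      simp only [Submodule.coe_sub, PiLp.add_apply, PiLp.sub_apply] at this ⊢
      linarith).1
    rw [map_add] at h1
    rw [map_sub] at h2
    linarith
  have key' : ∀ h : E, c h ≤ (b - a) / 2 * relNorm x₀ y h := by
    intro h
    rcases (relNorm_nonneg (x₀ := x₀) y h).eq_or_lt with h0 | h0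
    · rw [eq_zero_of_relNorm_eq_zero hy h0.symm]
      simpa using mul_nonneg hab (relNorm_nonneg (x₀ := x₀) y 0)
    · have hscale : relNorm x₀ y ((relNorm x₀ y h)⁻¹ • h) ≤ 1 := by
        refine Real.sqrt_le_one.2 (le_of_eq ?_)
        simp only [Submodule.coe_smul, PiLp.smul_apply, smul_eq_mul, mul_div_assoc, mul_pow]
        rw [← Finset.mul_sum, ← relNorm_sq, inv_pow, inv_mul_cancel₀ (by positivity)]
      have := key _ hscale
      rwa [map_smul, smul_eq_mul, inv_mul_le_iff₀ h0, mul_comm] at this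
  refine DualBound.localNorm_inverse_le hy hab fun h => abs_le'.2 ⟨key' h, ?_⟩
  rw [← map_neg]
  refine (key' (-h)).trans_eq ?_
  simp [relNorm, neg_div]

/-- The gradient at the starting point is bounded in all local norms. -/
lemma dualBound_fderiv_zero {ρ : ℝ} (hρ : 0 < ρ) (hx₀ : ∀ j, ρ ≤ x₀ j) {u : E}
    (hu : u ∈ sliceDomain E x₀) (hsum : ∑ j, (x₀ + (u : EuclideanSpace ℝ ι)) j = 1) :
    DualBound x₀ u (fderiv ℝ (sliceBarrier E x₀) 0) ρ⁻¹ := by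
  intro h
  have h0 : (0 : E) ∈ sliceDomain E x₀ := fun j => by simpa using hρ.trans_le (hx₀ j)
  rw [fderiv_sliceBarrier h0, abs_neg]
  have heq : ∑ j, (h : EuclideanSpace ℝ ι) j / (x₀ + ((0 : E) : EuclideanSpace ℝ ι)) j =
      ∑ j, ((x₀ + (u : EuclideanSpace ℝ ι)) j / x₀ j) *
        ((h : EuclideanSpace ℝ ι) j / (x₀ + (u : EuclideanSpace ℝ ι)) j) := by
    refine Finset.sum_congr rfl fun j _ => ?_
    rw [Submodule.coe_zero, add_zero, mul_comm, div_mul_div_cancel₀ (hu j).ne']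
  rw [heq]
  refine (abs_sum_mul_le _ _).trans (mul_le_mul_of_nonneg_right ?_ (relNorm_nonneg _ _))
  refine Real.sqrt_le_iff.2 ⟨by positivity, ?_⟩
  -- Bounding the Euclidean norm by the sum lets the unit total mass enter.
  calc ∑ j, ((x₀ + (u : EuclideanSpace ℝ ι)) j / x₀ j) ^ 2
      ≤ (∑ j, (x₀ + (u : EuclideanSpace ℝ ι)) j / x₀ j) ^ 2 :=
        Finset.sum_sq_le_sq_sum_of_nonneg fun j _ =>
          div_nonneg (hu j).le (hρ.le.trans (hx₀ j))
    _ ≤ (∑ j, (x₀ + (u : EuclideanSpace ℝ ι)) j * ρ⁻¹) ^ 2 := by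
        refine pow_le_pow_left₀ (Finset.sum_nonneg fun j _ =>
          div_nonneg (hu j).le (hρ.le.trans (hx₀ j))) (Finset.sum_le_sum fun j _ => ?_) 2
        rw [div_eq_mul_inv]
        exact mul_le_mul_of_nonneg_left (inv_anti₀ hρ (hx₀ j)) (hu j).le
    _ = _ := by rw [← Finset.sum_mul, hsum, one_mul]

/-! ### The iteration count -/

lemma one_sub_pow_le_of_log_le {δ a : ℝ} {k : ℕ} (hδ : δ ≤ 1) (ha : 0 < a)
    (h : Real.log a ≤ δ * k) : (1 - δ) ^ k ≤ a⁻¹ := by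
  calc (1 - δ) ^ k ≤ Real.exp (-δ) ^ k :=
        pow_le_pow_left₀ (by linarith) (by linarith [Real.add_one_le_exp (-δ)]) k
    _ = Real.exp (-(δ * k)) := by rw [← Real.exp_nat_mul]; congr 1; ring
    _ ≤ Real.exp (-Real.log a) := Real.exp_le_exp.2 (by linarith)
    _ = a⁻¹ := by rw [Real.exp_neg, Real.exp_log ha]

lemma le_one_add_pow_of_log_le {δ a : ℝ} {k : ℕ} (hδ0 : 0 ≤ δ) (hδ : δ ≤ 1) (ha : 0 < a)
    (h : Real.log a ≤ δ / 2 * k) : a ≤ (1 + δ) ^ k := by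
  -- From `log(1+δ) ≥ δ/(1+δ) ≥ δ/2` for `δ ≤ 1`.
  have hexp : Real.exp (δ / 2) ≤ 1 + δ := by
    have h2 := Real.one_sub_inv_le_log_of_pos (show 0 < 1 + δ by linarith)
    have h3 : δ / 2 ≤ 1 - (1 + δ)⁻¹ := by
      rw [le_sub_iff_add_le, ← le_sub_iff_add_le', inv_le_comm₀ (by linarith) (by linarith),
        inv_le_iff_one_le_mul₀ (by linarith)]
      nlinarith
    exact (Real.le_log_iff_exp_le (by linarith)).1 (h3.trans h2)
  calc a = Real.exp (Real.log a) := (Real.exp_log ha).symm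
    _ ≤ Real.exp (k * (δ / 2)) := Real.exp_le_exp.2 (by linarith)
    _ = Real.exp (δ / 2) ^ k := Real.exp_nat_mul _ _
    _ ≤ (1 + δ) ^ k := pow_le_pow_left₀ (Real.exp_pos _).le hexp k

/-- The number of iterations that suffices for the first stage. -/
def centeringBound (ϑ ρ : ℝ) : ℕ := ⌈8 * √ϑ * Real.log (63 / 2 * ρ⁻¹)⌉₊

lemma tracks_iterate_centeringBound {c : E →L[ℝ] ℝ} {ϑ ρ : ℝ} (hρ : 0 < ρ)
    (hx₀ : ∀ j, ρ ≤ x₀ j) (hsum : ∀ u : E, ∑ j, (x₀ + (u : EuclideanSpace ℝ ι)) j = 1)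
    (hϑ : 1 ≤ ϑ) (hc : complexityValue (sliceBarrier E x₀) (sliceDomain E x₀) ≤ ENNReal.ofReal ϑ)
    (N : ℕ) :
    Tracks x₀ c ϑ (centeringBound ϑ ρ) N
      ((shortStep (sliceBarrier E x₀) c 0 ϑ)^[N]
        { phase := Phase.centering, point := 0, param := 1 }) := by
  have hs1 : 1 ≤ √ϑ := Real.one_le_sqrt.2 hϑ
  refine tracks_iterate (R := ρ⁻¹) (fun j => hρ.trans_le (hx₀ j)) hϑ
    (fun u hu => dualBound_fderiv hϑ hc hu)
    (fun u hu => dualBound_fderiv_zero hρ hx₀ hu (hsum u)) ?_ N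
  have hδ1 : 1 / (8 * √ϑ) ≤ 1 := by
    rw [div_le_one (by positivity)]
    linarith
  have h1 : Real.log (63 / 2 * ρ⁻¹) ≤ 1 / (8 * √ϑ) * centeringBound ϑ ρ := by
    rw [one_div_mul_eq_div, le_div_iff₀ (by positivity), mul_comm]
    exact Nat.le_ceil _
  have h2 := one_sub_pow_le_of_log_le hδ1 (by positivity) h1
  calc (1 - 1 / (8 * √ϑ)) ^ centeringBound ϑ ρ * ρ⁻¹ ≤ (63 / 2 * ρ⁻¹)⁻¹ * ρ⁻¹ := by gcongr
    _ = 2 / 63 := by field_simp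

lemma shortStepIterate_mem {c : E →L[ℝ] ℝ} {ϑ ρ : ℝ} (hρ : 0 < ρ)
    (hx₀ : ∀ j, ρ ≤ x₀ j) (hsum : ∀ u : E, ∑ j, (x₀ + (u : EuclideanSpace ℝ ι)) j = 1)
    (hc : complexityValue (sliceBarrier E x₀) (sliceDomain E x₀) ≤ ENNReal.ofReal ϑ) (N : ℕ) :
    shortStepIterate (sliceBarrier E x₀) c 0 ϑ N ∈ sliceDomain E x₀ := by
  rcases subsingleton_or_nontrivial E with hE | hE
  · rw [Subsingleton.elim (shortStepIterate (sliceBarrier E x₀) c 0 ϑ N) 0]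
    exact fun j => by simpa using hρ.trans_le (hx₀ j)
  · have hϑ := one_le_of_complexityValue_le (fun j => hρ.trans_le (hx₀ j)) hc
    exact (tracks_iterate_centeringBound hρ hx₀ hsum hϑ hc N).1

/-- The number of iterations prescribed covers both stages. -/
lemma iteration_count {M ϑ ρ ε N : ℝ} (hM : 1 ≤ M) (hϑ : 1 ≤ ϑ) (hϑM : ϑ ≤ M) (hρ : 0 < ρ)
    (hρ1 : ρ ≤ 1) (hε : 0 < ε) (hε1 : ε < 1)
    (hN : 300 * (√M * Real.log (√2 * ε⁻¹ * (M * ρ⁻¹))) ≤ N) :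
    centeringBound ϑ ρ + 1 + 16 * √ϑ * Real.log (12 * M * ε⁻¹) ≤ N := by
  set L := Real.log (√2 * ε⁻¹ * (M * ρ⁻¹)) with hL
  have hM0 : 0 < M := by linarith
  -- All four summands are nonnegative, so each logarithm below is absorbed by a multiple of `L`;
  -- the `√2` keeps `L` away from zero and absorbs the constants.
  have hlogs : L = Real.log 2 / 2 + Real.log ε⁻¹ + (Real.log M + Real.log ρ⁻¹) := by
    rw [hL, Real.log_mul (by positivity) (by positivity),
      Real.log_mul (by positivity) (by positivity), Real.log_mul (by positivity) (by positivity),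
      Real.log_sqrt (by norm_num)]
  have hlε : 0 ≤ Real.log ε⁻¹ := Real.log_nonneg ((one_le_inv₀ hε).2 hε1.le)
  have hlρ : 0 ≤ Real.log ρ⁻¹ := Real.log_nonneg ((one_le_inv₀ hρ).2 hρ1)
  have hlM : 0 ≤ Real.log M := Real.log_nonneg hM
  have hl2 : 0.69 < Real.log 2 := by linarith [Real.log_two_gt_d9]
  have h63 : Real.log (63 / 2 * ρ⁻¹) ≤ 11 * L := by
    have : Real.log (63 / 2) ≤ 5 * Real.log 2 := by
      rw [← Real.log_rpow (by norm_num)]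
      exact Real.log_le_log (by norm_num) (by norm_num)
    rw [Real.log_mul (by norm_num) (by positivity)]
    linarith
  have h630 : 0 ≤ Real.log (63 / 2 * ρ⁻¹) := by
    rw [Real.log_mul (by norm_num) (by positivity)]
    linarith [Real.log_nonneg (show (1 : ℝ) ≤ 63 / 2 by norm_num)]
  have h12 : Real.log (12 * M * ε⁻¹) ≤ 9 * L := by
    have : Real.log 12 ≤ 4 * Real.log 2 := by
      rw [← Real.log_rpow (by norm_num)]
      exact Real.log_le_log (by norm_num) (by norm_num)
    rw [Real.log_mul (by positivity) (by positivity), Real.log_mul (by norm_num) (by positivity)]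
    linarith
  have hL0 : 0.34 ≤ L := by linarith
  have hsϑ : 0 ≤ √ϑ := Real.sqrt_nonneg ϑ
  have hsM : 1 ≤ √M := Real.one_le_sqrt.2 hM
  have hsle : √ϑ ≤ √M := Real.sqrt_le_sqrt hϑM
  have hceil : (centeringBound ϑ ρ : ℝ) < 8 * √ϑ * Real.log (63 / 2 * ρ⁻¹) + 1 :=
    Nat.ceil_lt_add_one (by positivity)
  have e1 : √ϑ * Real.log (63 / 2 * ρ⁻¹) ≤ √M * (11 * L) := by gcongr
  have e2 : √ϑ * Real.log (12 * M * ε⁻¹) ≤ √M * (9 * L) :=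
    (mul_le_mul_of_nonneg_left h12 hsϑ).trans
      (mul_le_mul_of_nonneg_right hsle (by linarith))
  -- Absorbs the ceiling and the switching step; the total is `88 + 144` multiples of `√M L` plus
  -- `2`, below `300`.
  have e3 : 0.34 ≤ √M * L := by nlinarith
  linarith

/-- Accuracy of the short-step method on a slice of the unit simplex. -/
theorem shortStepIterate_accuracy [Nontrivial E] {c : E →L[ℝ] ℝ} {ϑ ρ a b ε : ℝ} {N : ℕ}
    (hρ : 0 < ρ) (hρ1 : ρ ≤ 1) (hx₀ : ∀ j, ρ ≤ x₀ j)
    (hsum : ∀ u : E, ∑ j, (x₀ + (u : EuclideanSpace ℝ ι)) j = 1)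
    (hc : complexityValue (sliceBarrier E x₀) (sliceDomain E x₀) ≤ ENNReal.ofReal ϑ)
    (hϑM : ϑ ≤ Fintype.card ι)
    (hrange : ∀ u : E, (∀ j, 0 ≤ (x₀ + (u : EuclideanSpace ℝ ι)) j) → a ≤ c u ∧ c u ≤ b)
    (hε : 0 < ε) (hε1 : ε < 1)
    (hN : 300 * (√(Fintype.card ι) * Real.log (√2 * ε⁻¹ * (Fintype.card ι * ρ⁻¹))) ≤ N)
    {y : E} (hy : ∀ j, 0 ≤ (x₀ + (y : EuclideanSpace ℝ ι)) j) :
    c (shortStepIterate (sliceBarrier E x₀) c 0 ϑ N - y) ≤ ε * (b - a) := by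
  have hϑ := one_le_of_complexityValue_le (fun j => hρ.trans_le (hx₀ j)) hc
  have hs1 : 1 ≤ √ϑ := Real.one_le_sqrt.2 hϑ
  have hM := hϑ.trans hϑM
  have hcount := iteration_count hM hϑ hϑM hρ hρ1 hε hε1 hN
  have htr := tracks_iterate_centeringBound (c := c) hρ hx₀ hsum hϑ hc N
  unfold shortStepIterate
  set s := (shortStep (sliceBarrier E x₀) c 0 ϑ)^[N]
        { phase := Phase.centering, point := 0, param := 1 }
  have hlog : 0 ≤ Real.log (12 * Fintype.card ι * ε⁻¹) := by
    refine Real.log_nonneg ?_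
    have := (one_le_inv₀ hε).2 hε1.le
    nlinarith
  have hterm : 0 ≤ 16 * √ϑ * Real.log (12 * Fintype.card ι * ε⁻¹) := by positivity
  obtain ⟨hu, ⟨-, hk, -⟩ | ⟨-, j, hj, hjN, z, hz, hη, hd⟩⟩ := htr
  -- Still being in the first stage contradicts the iteration count.
  · have : (N : ℝ) ≤ centeringBound ϑ ρ := by exact_mod_cast hk
    linarith
  set m := localNorm (sliceBarrier E x₀) z ((hessian (sliceBarrier E x₀) z).inverse c) with hm
  have hm0 : 0 ≤ m := Real.sqrt_nonneg _
  have hab := localNorm_inverse_le_of_range hrange hz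
  rw [← hm] at hab
  rcases hm0.eq_or_lt with h0 | hmpos
  · have := (le_abs_self _).trans (dualBound_localNorm_inverse hz c (s.point - y))
    rw [← hm, ← h0, zero_mul] at this
    exact this.trans (mul_nonneg hε.le (by linarith))
  have hgap := (hd.mono (by norm_num)).objective_gap hu hy
  have hpow : 12 * Fintype.card ι * ε⁻¹ ≤ (1 + 1 / (8 * √ϑ)) ^ (N - (j + 1)) := by
    refine le_one_add_pow_of_log_le (by positivity) ?_ (by positivity) ?_
    · rw [div_le_one (by positivity)]
      linarith
    · have h1 : (N : ℝ) - (centeringBound ϑ ρ + 1) ≤ ((N - (j + 1) : ℕ) : ℝ) := by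
        rw [Nat.cast_sub hjN]
        have : (j : ℝ) ≤ centeringBound ϑ ρ := by exact_mod_cast hj
        push_cast
        linarith
      have h2 : 16 * √ϑ * Real.log (12 * Fintype.card ι * ε⁻¹) ≤ ((N - (j + 1) : ℕ) : ℝ) := by
        linarith
      have h3 : 1 / (8 * √ϑ) / 2 * (16 * √ϑ * Real.log (12 * Fintype.card ι * ε⁻¹)) =
          Real.log (12 * Fintype.card ι * ε⁻¹) := by
        field_simp
        norm_num
      rw [← h3]
      exact mul_le_mul_of_nonneg_left h2 (by positivity)
  set q := (1 + 1 / (8 * √ϑ)) ^ (N - (j + 1))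
  have hqpos : 0 < q := by positivity
  have h1 : q * c (s.point - y) ≤ 24 * Fintype.card ι * m := by
    rw [hη, mul_assoc, one_div_mul_eq_div, mul_div_assoc', div_le_iff₀ (by positivity)] at hgap
    linarith
  have h2 : 12 * (Fintype.card ι : ℝ) ≤ q * ε := by
    rwa [← div_eq_mul_inv, div_le_iff₀ hε] at hpow
  have h3 : q * c (s.point - y) ≤ q * (ε * (b - a)) := by
    have h4 : 24 * Fintype.card ι * m ≤ 12 * Fintype.card ι * (b - a) := by
      have : (0 : ℝ) ≤ Fintype.card ι := by positivity
      nlinarith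
    have h5 := mul_le_mul_of_nonneg_right h2 (show 0 ≤ b - a by linarith)
    linarith
  exact le_of_mul_le_mul_left h3 hqpos

end Slice

/-! ### The transport polytope as a slice of the unit simplex -/

variable {d : ℕ} {n : Fin d → ℕ}

lemma marginal_add (X Y : Tensor n) (k : Fin d) (i : Fin (n k)) :
    marginal (X + Y) k i = marginal X k i + marginal Y k i := by
  simp only [marginal, ← Finset.sum_add_distrib]
  refine Finset.sum_congr rfl fun j _ => ?_
  split_ifs <;> simp

lemma sum_marginal (X : Tensor n) (k : Fin d) : ∑ i, marginal X k i = ∑ j, X j := by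
  simp only [marginal]
  rw [Finset.sum_comm]
  simp

lemma marginal_productTensor {p : (k : Fin d) → Fin (n k) → ℝ} (hp : ∀ k, ∑ i, p k i = 1)
    (k : Fin d) (i : Fin (n k)) : marginal (productTensor p) k i = p k i := by
  -- Moving the indicator of `j k = i` into the `k`-th factor keeps a product form, so the sum
  -- factorizes.
  let q : (k : Fin d) → Fin (n k) → ℝ := Function.update p k fun a => if a = i then p k a else 0
  have hqk : q k = fun a => if a = i then p k a else 0 := Function.update_self ..
  have hql : ∀ l, l ≠ k → q l = p l := fun l hl => Function.update_of_ne hl ..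
  have hterm : ∀ j : (k : Fin d) → Fin (n k),
      (if j k = i then productTensor p j else 0) = ∏ l, q l (j l) := by
    intro j
    rw [← Finset.mul_prod_erase Finset.univ _ (Finset.mem_univ k), hqk,
      Finset.prod_congr rfl fun l hl => by rw [hql l (Finset.ne_of_mem_erase hl)]]
    beta_reduce
    split_ifs with h
    · exact (Finset.mul_prod_erase Finset.univ (fun l => p l (j l)) (Finset.mem_univ k)).symm
    · rw [zero_mul]
  unfold marginal
  rw [Finset.sum_congr rfl fun j _ => hterm j, ← Fintype.prod_sum,
    ← Finset.mul_prod_erase Finset.univ _ (Finset.mem_univ k), hqk,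
    Finset.prod_eq_one fun l hl => by rw [hql l (Finset.ne_of_mem_erase hl), hp l]]
  simp

lemma sum_eq_one_of_marginal {p : (k : Fin d) → Fin (n k) → ℝ} {X : Tensor n} (k : Fin d)
    (hp : ∑ i, p k i = 1) (hX : ∀ i, marginal X k i = p k i) : ∑ j, X j = 1 := by
  rw [← sum_marginal X k, ← hp]
  exact Finset.sum_congr rfl fun i _ => hX i

lemma marginal_productTensor_add {p : (k : Fin d) → Fin (n k) → ℝ} (hp : ∀ k, ∑ i, p k i = 1)
    (u : zeroMarginals n) (k : Fin d) (i : Fin (n k)) :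
    marginal (productTensor p + (u : Tensor n)) k i = p k i := by
  rw [marginal_add, marginal_productTensor hp, u.2 k i, add_zero]

lemma productTensor_add_mem_polytope {p : (k : Fin d) → Fin (n k) → ℝ}
    (hp : ∀ k, ∑ i, p k i = 1) (u : zeroMarginals n)
    (hu : ∀ j, 0 ≤ (productTensor p + (u : Tensor n)) j) :
    productTensor p + (u : Tensor n) ∈ polytope p :=
  ⟨hu, marginal_productTensor_add hp u⟩

lemma exists_eq_productTensor_add {p : (k : Fin d) → Fin (n k) → ℝ} (hp : ∀ k, ∑ i, p k i = 1)
    {U : Tensor n} (hU : U ∈ polytope p) :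
    ∃ u : zeroMarginals n, U = productTensor p + (u : Tensor n) := by
  refine ⟨⟨U - productTensor p, fun k i => ?_⟩, (add_sub_cancel _ _).symm⟩
  have := marginal_add (productTensor p) (U - productTensor p) k i
  rw [add_sub_cancel, hU.2 k i, marginal_productTensor hp] at this
  linarith

/-- Boundedness of the objective makes `optValue` and `maxValue` genuine bounds rather than default
values of `sInf` and `sSup`. -/
lemma abs_inner_le_of_mem_polytope {p : (k : Fin d) → Fin (n k) → ℝ} (k : Fin d)
    (hp : ∑ i, p k i = 1) (C : Tensor n) {U : Tensor n} (hU : U ∈ polytope p) :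
    |inner ℝ C U| ≤ ‖C‖ := by
  have hnorm : ‖U‖ ≤ 1 := by
    rw [EuclideanSpace.norm_eq, Real.sqrt_le_one]
    calc ∑ j, ‖U j‖ ^ 2 = ∑ j, U j ^ 2 := by simp
      _ ≤ (∑ j, U j) ^ 2 := Finset.sum_sq_le_sq_sum_of_nonneg fun j _ => hU.1 j
      _ = 1 := by rw [sum_eq_one_of_marginal k hp (hU.2 k), one_pow]
  exact (abs_real_inner_le_norm C U).trans (mul_le_of_le_one_right (norm_nonneg C) hnorm)

lemma optValue_le {p : (k : Fin d) → Fin (n k) → ℝ} (k : Fin d)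
    (hp : ∑ i, p k i = 1) (C : Tensor n) {U : Tensor n} (hU : U ∈ polytope p) :
    optValue C p ≤ inner ℝ C U := by
  refine csInf_le ⟨-‖C‖, ?_⟩ ⟨U, hU, rfl⟩
  rintro _ ⟨V, hV, rfl⟩
  exact (abs_le.1 (abs_inner_le_of_mem_polytope k hp C hV)).1

lemma le_maxValue {p : (k : Fin d) → Fin (n k) → ℝ} (k : Fin d)
    (hp : ∑ i, p k i = 1) (C : Tensor n) {U : Tensor n} (hU : U ∈ polytope p) :
    inner ℝ C U ≤ maxValue C p := by
  refine le_csSup ⟨‖C‖, ?_⟩ ⟨U, hU, rfl⟩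
  rintro _ ⟨V, hV, rfl⟩
  exact (abs_le.1 (abs_inner_le_of_mem_polytope k hp C hV)).2

lemma inner_productTensor_add (C : Tensor n) (p : (k : Fin d) → Fin (n k) → ℝ)
    (u : zeroMarginals n) :
    inner ℝ C (productTensor p + (u : Tensor n)) = inner ℝ C (productTensor p) + objective C u :=
  inner_add_right _ _ _

/-- Comparing with every feasible `y` passes to the infimum directly, so no minimizer is needed. -/
lemma findsValue_of_accuracy {p : (k : Fin d) → Fin (n k) → ℝ} (k : Fin d)
    (hp : ∀ k, ∑ i, p k i = 1) (C : Tensor n) {ε : ℝ} {u : zeroMarginals n}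
    (hu : ∀ j, 0 < (productTensor p + (u : Tensor n)) j)
    (hacc : ∀ y : zeroMarginals n, (∀ j, 0 ≤ (productTensor p + (y : Tensor n)) j) →
      objective C (u - y) ≤ ε * (maxValue C p - optValue C p)) :
    FindsValue C p ε (productTensor p + (u : Tensor n)) := by
  have hmem := productTensor_add_mem_polytope hp u fun j => (hu j).le
  refine ⟨hmem, hu, ?_⟩
  rw [abs_of_nonneg (sub_nonneg.2 (optValue_le k (hp k) C hmem)), sub_le_comm]
  refine le_csInf ⟨_, _, hmem, rfl⟩ ?_
  rintro _ ⟨U, hU, rfl⟩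
  obtain ⟨y, rfl⟩ := exists_eq_productTensor_add hp hU
  have := hacc y hU.1
  rw [map_sub] at this
  simp only [inner_productTensor_add]
  linarith

/-! ### Weakly uniform marginals -/

section WeakUniform

variable {p : (k : Fin d) → Fin (n k) → ℝ} {K ℓ : ℝ}

lemma IsWeakUniform.pos_dim {m : ℕ} {q : Fin m → ℝ} (h : IsWeakUniform K ℓ q) : 0 < m := by
  rcases Nat.eq_zero_or_pos m with rfl | hm
  · simpa using h.sum_eq_one
  · exact hm

lemma IsWeakUniform.lower_pos {m : ℕ} {q : Fin m → ℝ} (h : IsWeakUniform K ℓ q) :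
    0 < K / (m : ℝ) ^ ℓ :=
  div_pos h.K_pos (Real.rpow_pos_of_pos (Nat.cast_pos.2 h.pos_dim) _)

lemma IsWeakUniform.lower_le_one {m : ℕ} {q : Fin m → ℝ} (h : IsWeakUniform K ℓ q) :
    K / (m : ℝ) ^ ℓ ≤ 1 := by
  rw [div_le_one (Real.rpow_pos_of_pos (Nat.cast_pos.2 h.pos_dim) _)]
  exact h.K_le.trans (Real.rpow_le_rpow_of_exponent_le (Nat.one_le_cast.2 h.pos_dim) (by linarith))

lemma prod_lower_le_productTensor (hw : ∀ k, IsWeakUniform K ℓ (p k))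
    (j : (k : Fin d) → Fin (n k)) : ∏ k, K / (n k : ℝ) ^ ℓ ≤ productTensor p j :=
  Finset.prod_le_prod (fun k _ => (hw k).lower_pos.le) fun k _ => (hw k).lower (j k)

lemma card_mul_prod_lower_inv (hw : ∀ k, IsWeakUniform K ℓ (p k)) (hK : 0 < K) :
    (∏ k, (n k : ℝ)) * (∏ k, K / (n k : ℝ) ^ ℓ)⁻¹ =
      K ^ (-(d : ℝ)) * ∏ k, (n k : ℝ) ^ (1 + ℓ) := by
  have hn : ∀ k, (0 : ℝ) < n k := fun k => Nat.cast_pos.2 (hw k).pos_dim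
  have hK' : K ^ (-(d : ℝ)) = ∏ _k : Fin d, K⁻¹ := by
    rw [Real.rpow_neg hK.le, Real.rpow_natCast, Finset.prod_const, Finset.card_univ,
      Fintype.card_fin, inv_pow]
  rw [hK', ← Finset.prod_inv_distrib, ← Finset.prod_mul_distrib, ← Finset.prod_mul_distrib]
  refine Finset.prod_congr rfl fun k _ => ?_
  rw [Real.rpow_add (hn k), Real.rpow_one, inv_div]
  ring

lemma card_index : Fintype.card ((k : Fin d) → Fin (n k)) = ∏ k, n k := by
  simp

lemma findsValue_ipmIterate (hd : 0 < d) (hw : ∀ k, IsWeakUniform K ℓ (p k)) (C : Tensor n)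
    {ϑ : ℝ} (hϑ : complexityValue (restrictedBarrier p) (barrierDomain p) ≤ ENNReal.ofReal ϑ)
    (hϑM : ϑ ≤ ∏ k, (n k : ℝ)) {ε : ℝ} (hε : 0 < ε) {N : ℕ}
    (hN : 300 * (√(∏ k, (n k : ℝ)) *
      Real.log (√2 * ε⁻¹ * K ^ (-(d : ℝ)) * ∏ k, (n k : ℝ) ^ (1 + ℓ))) ≤ N) :
    FindsValue C p ε (ipmIterate C p ϑ N) := by
  let k₀ : Fin d := ⟨0, hd⟩
  have hp : ∀ k, ∑ i, p k i = 1 := fun k => (hw k).sum_eq_one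
  have hρ : 0 < ∏ k, K / (n k : ℝ) ^ ℓ := Finset.prod_pos fun k _ => (hw k).lower_pos
  have hρ1 : ∏ k, K / (n k : ℝ) ^ ℓ ≤ 1 :=
    Finset.prod_le_one (fun k _ => (hw k).lower_pos.le) fun k _ => (hw k).lower_le_one
  have hsum : ∀ u : zeroMarginals n, ∑ j, (productTensor p + (u : Tensor n)) j = 1 := fun u =>
    sum_eq_one_of_marginal k₀ (hp k₀) (marginal_productTensor_add hp u k₀)
  -- `restrictedBarrier p` and `barrierDomain p` unfold to the slice barrier and domain of
  -- `zeroMarginals n` at `productTensor p`.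
  have hmem : shortStepIterate (restrictedBarrier p) (objective C) 0 ϑ N ∈ barrierDomain p :=
    shortStepIterate_mem hρ (prod_lower_le_productTensor hw) hsum hϑ N
  have hrange : ∀ u : zeroMarginals n, (∀ j, 0 ≤ (productTensor p + (u : Tensor n)) j) →
      optValue C p - inner ℝ C (productTensor p) ≤ objective C u ∧
        objective C u ≤ maxValue C p - inner ℝ C (productTensor p) := by
    intro u hu
    have hU := productTensor_add_mem_polytope hp u hu
    have h1 := optValue_le k₀ (hp k₀) C hU
    have h2 := le_maxValue k₀ (hp k₀) C hU
    rw [inner_productTensor_add] at h1 h2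
    constructor <;> linarith
  refine findsValue_of_accuracy k₀ hp C hmem fun y hy => ?_
  have hu := hrange _ fun j => (hmem j).le
  have hy' := hrange y hy
  rcases subsingleton_or_nontrivial (zeroMarginals n) with hE | hE
  · rw [Subsingleton.elim (_ - y) 0, map_zero]
    exact mul_nonneg hε.le (by linarith)
  rcases lt_or_ge ε 1 with hε1 | hε1
  · have hcard : ((Fintype.card ((k : Fin d) → Fin (n k)) : ℕ) : ℝ) = ∏ k, (n k : ℝ) := by
      rw [card_index, Nat.cast_prod]
    have := shortStepIterate_accuracy hρ hρ1 (prod_lower_le_productTensor hw) hsum hϑ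
      (by rwa [hcard]) hrange hε hε1 (N := N)
      (by rwa [hcard, card_mul_prod_lower_inv hw (hw k₀).K_pos, ← mul_assoc (√2 * ε⁻¹)]) hy
    rwa [sub_sub_sub_cancel_right] at this
  -- For `ε ≥ 1` any feasible point is accurate enough, whatever `N` is.
  · rw [map_sub]
    have : maxValue C p - optValue C p ≤ ε * (maxValue C p - optValue C p) :=
      le_mul_of_one_le_left (by linarith) hε1
    linarith [hu.2, hy'.1]

end WeakUniform

end TensorOT

end

theorem corollary2p8 :
    ∃ A : ℝ, 0 < A ∧
      ∀ (d : ℕ) (_ : 2 ≤ d) (n : Fin d → ℕ) (p : (k : Fin d) → Fin (n k) → ℝ) (K ℓ : ℝ)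
        (_ : ∀ k, TensorOT.IsWeakUniform K ℓ (p k)),
        TensorOT.complexityValue (TensorOT.restrictedBarrier p) (TensorOT.barrierDomain p)
            ≤ ∏ k, (n k : ENNReal) ∧
        ∀ (C : TensorOT.Tensor n) (ϑ : ℝ)
          (_ : TensorOT.complexityValue (TensorOT.restrictedBarrier p) (TensorOT.barrierDomain p)
            ≤ ENNReal.ofReal ϑ)
          (_ : ϑ ≤ ∏ k, (n k : ℝ)) (ε : ℝ) (_ : 0 < ε),
          (∀ N : ℕ,
            A * (√(∏ k, (n k : ℝ)) *
              Real.log (√2 * ε⁻¹ * K ^ (-(d : ℝ)) * ∏ k, (n k : ℝ) ^ (1 + ℓ))) ≤ (N : ℝ) →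
            TensorOT.FindsValue C p ε (TensorOT.ipmIterate C p ϑ N)) ∧
          (∀ m : ℕ, (∀ k, n k = m) → ∀ N : ℕ,
            A * ((m : ℝ) ^ ((d : ℝ) / 2) *
              Real.log (√2 * ε⁻¹ * K ^ (-(d : ℝ)) * (m : ℝ) ^ ((d : ℝ) * (1 + ℓ)))) ≤ (N : ℝ) →
            TensorOT.FindsValue C p ε (TensorOT.ipmIterate C p ϑ N)) := by
  refine ⟨300, by norm_num, fun d hd n p K ℓ hw => ⟨?_, fun C ϑ hϑ hϑM ε hε => ?_⟩⟩
  · refine (TensorOT.complexityValue_sliceBarrier_le (E := TensorOT.zeroMarginals n)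
      (x₀ := TensorOT.productTensor p)).trans_eq ?_
    rw [TensorOT.card_index, Nat.cast_prod]
  · have main : ∀ N : ℕ, _ → _ := fun N hN =>
      TensorOT.findsValue_ipmIterate (by omega) hw C hϑ hϑM hε (N := N) hN
    refine ⟨main, fun m hm N hN => main N ?_⟩
    have hm0 : (0 : ℝ) ≤ m := Nat.cast_nonneg m
    have h1 : √(∏ k, (n k : ℝ)) = (m : ℝ) ^ ((d : ℝ) / 2) := by
      simp only [hm, Finset.prod_const, Finset.card_univ, Fintype.card_fin]
      rw [Real.sqrt_eq_rpow, ← Real.rpow_natCast, ← Real.rpow_mul hm0, mul_one_div]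
    have h2 : ∏ k, (n k : ℝ) ^ (1 + ℓ) = (m : ℝ) ^ ((d : ℝ) * (1 + ℓ)) := by
      simp only [hm, Finset.prod_const, Finset.card_univ, Fintype.card_fin]
      rw [mul_comm, Real.rpow_mul hm0, Real.rpow_natCast]
    rwa [h1, h2]
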